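/- Let $G$ be a locally compact (Hausdorff) group. Let $M(G)$ be the measure algebra of $G$, that is, the complex algebra of all regular complex Borel measures on $G$, with convolution $(\mu * \nu)(E) = \int_G \nu(x^{-1}E)\, d\mu(x)$ as its product, and let $M_0(G) = \{\mu \in M(G) : \mu(G) = 0\}$ be its augmentation ideal. Then $M_0(G)$ is finitely generated as a left ideal of $M(G)$, that is, there exist $n \in \mathbb{N}$ and $\mu_1, \dots, \mu_n \in M(G)$ such that $$M_0(G) = M(G) * \mu_1 + \cdots + M(G) * \mu_n$$ (with no closure taken on the right-hand side), if and only if $G$ is compact. -/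

import Mathlib

open MeasureTheory

namespace MeasureAlg

section Regularity

variable {X : Type*} [TopologicalSpace X] [T2Space X] [MeasurableSpace X] [BorelSpace X]

theorem regular_of_le {m n : Measure X} [IsFiniteMeasure m] [m.Regular] (h : n ≤ m) :
    n.Regular := by
  have : IsFiniteMeasure n := isFiniteMeasure_of_le m h
  have : n.InnerRegularCompactLTTop := by
    refine ⟨fun A hA r hr => ?_⟩
    obtain ⟨K, hKA, hK, hlt⟩ := hA.1.exists_isCompact_sdiff_lt (measure_ne_top m A)
      (tsub_pos_of_lt hr).ne'
    refine ⟨K, hKA, hK, ?_⟩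
    by_contra hcon
    have h1 : n A ≤ n K + n (A \ K) := by
      rw [← measure_union_add_inter K (hA.1.diff hK.measurableSet)]
      refine le_add_right (measure_mono ?_)
      intro x hx
      by_cases hxK : x ∈ K
      · exact Or.inl hxK
      · exact Or.inr ⟨hx, hxK⟩
    have h2 : n A < r + (n A - r) := by
      refine lt_of_le_of_lt h1 ?_
      exact ENNReal.add_lt_add_of_le_of_lt (measure_ne_top n K) (not_lt.1 hcon)
        ((h (A \ K)).trans_lt hlt)
    rw [add_tsub_cancel_of_le hr.le] at h2
    exact lt_irrefl _ h2
  infer_instance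

theorem regular_add {m n : Measure X} [IsFiniteMeasure m] [IsFiniteMeasure n] [m.Regular]
    [n.Regular] : (m + n).Regular := by
  infer_instance

end Regularity

section Variation

variable {X : Type*} [MeasurableSpace X]

/-- A complex measure has finite total variation. -/
instance isFiniteMeasure_variation (μ : ComplexMeasure X) : IsFiniteMeasure μ.variation := by
  have h : μ.variation ≤ (ComplexMeasure.re μ).totalVariation +
      (ComplexMeasure.im μ).totalVariation := by
    refine VectorMeasure.variation_le_of_forall_enorm_le fun E _ => ?_
    have h1 := (ComplexMeasure.re μ).enorm_le_totalVariation E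
    have h2 := (ComplexMeasure.im μ).enorm_le_totalVariation E
    have h3 : μ E = ((ComplexMeasure.re μ E : ℝ) : ℂ) + ((ComplexMeasure.im μ E : ℝ) : ℂ) *
        Complex.I := (Complex.re_add_im (μ E)).symm
    calc ‖μ E‖ₑ ≤ ‖((ComplexMeasure.re μ E : ℝ) : ℂ)‖ₑ +
        ‖((ComplexMeasure.im μ E : ℝ) : ℂ) * Complex.I‖ₑ := by
          rw [h3]; exact enorm_add_le _ _
      _ = ‖ComplexMeasure.re μ E‖ₑ + ‖ComplexMeasure.im μ E‖ₑ := by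
          simp [← ofReal_norm]
      _ ≤ _ := by
          rw [Measure.add_apply]; gcongr
  exact isFiniteMeasure_of_le _ h

theorem re_totalVariation_le (μ : ComplexMeasure X) :
    (ComplexMeasure.re μ).totalVariation ≤ μ.variation := by
  rw [SignedMeasure.totalVariation_eq_variation]
  refine VectorMeasure.variation_le_of_forall_enorm_le fun E _ => ?_
  refine le_trans ?_ (VectorMeasure.enorm_measure_le_variation μ E)
  rw [← ofReal_norm, ← ofReal_norm]
  exact ENNReal.ofReal_le_ofReal (Complex.abs_re_le_norm (μ E))

theorem im_totalVariation_le (μ : ComplexMeasure X) :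
    (ComplexMeasure.im μ).totalVariation ≤ μ.variation := by
  rw [SignedMeasure.totalVariation_eq_variation]
  refine VectorMeasure.variation_le_of_forall_enorm_le fun E _ => ?_
  refine le_trans ?_ (VectorMeasure.enorm_measure_le_variation μ E)
  rw [← ofReal_norm, ← ofReal_norm]
  exact ENNReal.ofReal_le_ofReal (Complex.abs_im_le_norm (μ E))

/-- The integral `∫ f dμ` of a complex function against a complex measure. -/
noncomputable def cintegral (μ : ComplexMeasure X) (f : X → ℂ) : ℂ :=
  ∫ᵛ x, f x ∂[ContinuousLinearMap.mul ℝ ℂ; μ]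

theorem integrable_of_bounded (μ : ComplexMeasure X) {f : X → ℂ} (hf : Measurable f) {C : ℝ}
    (hC : ∀ x, ‖f x‖ ≤ C) : Integrable f μ.variation :=
  Integrable.of_bound hf.aestronglyMeasurable C (Filter.Eventually.of_forall hC)

theorem cintegral_add (μ : ComplexMeasure X) {f g : X → ℂ} (hf : Integrable f μ.variation)
    (hg : Integrable g μ.variation) :
    cintegral μ (fun x => f x + g x) = cintegral μ f + cintegral μ g :=
  VectorMeasure.integral_fun_add hf hg

theorem cintegral_indicator (μ : ComplexMeasure X) (c : ℂ) {s : Set X} (hs : MeasurableSet s) :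
    cintegral μ (s.indicator fun _ => c) = c * μ s := by
  simp [cintegral, VectorMeasure.integral_indicator_const _ hs]

theorem cintegral_add_measure (μ ν : ComplexMeasure X) {f : X → ℂ} (hf : Measurable f) {C : ℝ}
    (hC : ∀ x, ‖f x‖ ≤ C) : cintegral (μ + ν) f = cintegral μ f + cintegral ν f :=
  VectorMeasure.integral_add_vectorMeasure (integrable_of_bounded μ hf hC)
    (integrable_of_bounded ν hf hC)

theorem cintegral_const (μ : ComplexMeasure X) (c : ℂ) :
    cintegral μ (fun _ => c) = c * μ Set.univ := by
  simp [cintegral]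

theorem tendsto_cintegral (μ : ComplexMeasure X) {F : ℕ → X → ℂ} {f : X → ℂ}
    (hF : ∀ n, Measurable (F n)) {C : ℝ} (hC : ∀ n x, ‖F n x‖ ≤ C)
    (h : ∀ x, Filter.Tendsto (fun n => F n x) Filter.atTop (nhds (f x))) :
    Filter.Tendsto (fun n => cintegral μ (F n)) Filter.atTop (nhds (cintegral μ f)) :=
  VectorMeasure.tendsto_integral_filter_of_norm_le_const
    (Filter.Eventually.of_forall fun n => (hF n).aestronglyMeasurable)
    ⟨C, Filter.Eventually.of_forall fun n => Filter.Eventually.of_forall (hC n)⟩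
    (Filter.Eventually.of_forall h)

theorem norm_cintegral_le (μ : ComplexMeasure X) {f : X → ℂ} {C : ℝ} (hC : ∀ x, ‖f x‖ ≤ C) :
    ‖cintegral μ f‖ ≤ C * μ.variation.real Set.univ := by
  refine (VectorMeasure.norm_integral_le_of_norm_le_const
    (Filter.Eventually.of_forall hC)).trans ?_
  simp [ContinuousLinearMap.opNorm_mul]

theorem cintegral_const_mul (μ : ComplexMeasure X) (c : ℂ) {f : X → ℂ}
    (hf : Integrable f μ.variation) :
    cintegral μ (fun x => c * f x) = c * cintegral μ f := by
  have h1 := VectorMeasure.continuousLinearMap_apply_integral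
    (B := ContinuousLinearMap.mul ℝ ℂ) (C := ContinuousLinearMap.mul ℝ ℂ c) hf
  have h2 := VectorMeasure.integral_continuousLinearMap_comp
    (B := ContinuousLinearMap.mul ℝ ℂ) (C := ContinuousLinearMap.mul ℝ ℂ c) hf
  simp only [ContinuousLinearMap.mul_apply'] at h1 h2
  rw [cintegral, cintegral, h1, h2]
  congr 1
  refine ContinuousLinearMap.ext fun x => ContinuousLinearMap.ext fun y => ?_
  simp [mul_assoc]

theorem cintegral_smul_measure (μ : ComplexMeasure X) (c : ℂ) {f : X → ℂ} (hf : Measurable f)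
    {C : ℝ} (hC : ∀ x, ‖f x‖ ≤ C) : cintegral (c • μ) f = c * cintegral μ f := by
  have hs : ∀ g : SimpleFunc X ℂ, cintegral (c • μ) g = c * cintegral μ g := by
    intro g
    have hb : ∀ g : SimpleFunc X ℂ, ∀ ν : ComplexMeasure X, Integrable g ν.variation :=
      fun g ν => by
        obtain ⟨D, hD⟩ := g.exists_forall_norm_le
        exact integrable_of_bounded _ g.measurable hD
    classical
    induction g using SimpleFunc.induction with
    | @const d s hs =>
      have h3 : ⇑(SimpleFunc.piecewise s hs (SimpleFunc.const X d) (SimpleFunc.const X 0)) =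
          s.indicator (fun _ => d) := by
        rw [SimpleFunc.coe_piecewise, SimpleFunc.coe_const, SimpleFunc.coe_const]
        exact Set.piecewise_eq_indicator (f := fun _ => d)
      rw [h3, cintegral_indicator _ d hs, cintegral_indicator _ d hs, _root_.smul_apply,
        smul_eq_mul]
      ring
    | @add g h hgh ihg ihh =>
      have h1 : ∀ ν : ComplexMeasure X, cintegral ν ⇑(g + h) = cintegral ν g + cintegral ν h :=
        fun ν => cintegral_add ν (hb g ν) (hb h ν)
      rw [h1, h1, ihg, ihh, mul_add]
  rcases isEmpty_or_nonempty X with hX | ⟨⟨x₀⟩⟩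
  · simp [cintegral, VectorMeasure.integral_of_isEmpty]
  have hC0 : 0 ≤ C := (norm_nonneg _).trans (hC x₀)
  have hsm := hf.stronglyMeasurable
  have hlim : ∀ ν : ComplexMeasure X, Filter.Tendsto
      (fun n => cintegral ν (hsm.approxBounded C n)) Filter.atTop (nhds (cintegral ν f)) :=
    fun ν => tendsto_cintegral ν (fun n => (hsm.approxBounded C n).measurable)
      (fun n x => hsm.norm_approxBounded_le hC0 n x)
      fun x => hsm.tendsto_approxBounded_of_norm_le (hC x)
  refine tendsto_nhds_unique (hlim (c • μ)) ?_
  simp only [hs]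
  exact (hlim μ).const_mul c

end Variation

section Translation

set_option linter.unusedSectionVars false

variable {G : Type*} [Group G] [TopologicalSpace G] [IsTopologicalGroup G]
  [LocallyCompactSpace G] [T2Space G] [MeasurableSpace G] [BorelSpace G]

theorem exists_nhds_compact (n : Measure G) [n.Regular] {U : Set G}
    (hU : IsOpen U) {x : G} {t : ENNReal} (hx : t < n ((x * ·) ⁻¹' U)) :
    ∃ W ∈ nhds x, ∃ D, IsCompact D ∧ D ⊆ U ∧ ∀ y ∈ W, t < n ((y * ·) ⁻¹' D) := by
  obtain ⟨C, hCU, hC, hlt⟩ :=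
    (hU.preimage (continuous_const_mul x)).exists_lt_isCompact hx
  have hop : IsOpen {p : G × G | p.1 * p.2 ∈ U} := hU.preimage continuous_mul
  obtain ⟨V, V', hV, -, hxV, hCV', hVV'⟩ := generalized_tube_lemma
    (isCompact_singleton (x := x)) hC hop (by
      rintro ⟨a, b⟩ ⟨ha, hb⟩
      rw [Set.mem_singleton_iff] at ha
      subst ha
      exact hCU hb)
  obtain ⟨W, hW, hWV, hWc⟩ := local_compact_nhds (hV.mem_nhds (hxV rfl))
  refine ⟨W, hW, (fun p : G × G => p.1 * p.2) '' (W ×ˢ C),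
    (hWc.prod hC).image continuous_mul, ?_, fun y hy => ?_⟩
  · rintro _ ⟨⟨a, b⟩, ⟨ha, hb⟩, rfl⟩
    exact hVV' (Set.mk_mem_prod (hWV ha) (hCV' hb))
  · refine hlt.trans_le (measure_mono fun c hc => ?_)
    exact ⟨(y, c), ⟨hy, hc⟩, rfl⟩

theorem isOpen_lt_translate (n : Measure G) [n.Regular] {U : Set G}
    (hU : IsOpen U) (t : ENNReal) : IsOpen {x : G | t < n ((x * ·) ⁻¹' U)} := by
  rw [isOpen_iff_mem_nhds]
  intro x hx
  obtain ⟨W, hW, D, -, hDU, hD⟩ := exists_nhds_compact n hU hx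
  filter_upwards [hW] with y hy
  exact (hD y hy).trans_le (measure_mono (Set.preimage_mono hDU))

theorem exists_compact_of_compact (n : Measure G) [n.Regular] {U : Set G}
    (hU : IsOpen U) {t : ENNReal} {K : Set G} (hK : IsCompact K)
    (h : ∀ x ∈ K, t < n ((x * ·) ⁻¹' U)) :
    ∃ D, IsCompact D ∧ D ⊆ U ∧ ∀ y ∈ K, t < n ((y * ·) ⁻¹' D) := by
  refine hK.induction_on (p := fun S => ∃ D, IsCompact D ∧ D ⊆ U ∧
    ∀ y ∈ S, t < n ((y * ·) ⁻¹' D)) ?_ ?_ ?_ ?_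
  · exact ⟨∅, isCompact_empty, Set.empty_subset _, by simp⟩
  · rintro S T hST ⟨D, h1, h2, h3⟩
    exact ⟨D, h1, h2, fun y hy => h3 y (hST hy)⟩
  · rintro S T ⟨D, h1, h2, h3⟩ ⟨E, h4, h5, h6⟩
    refine ⟨D ∪ E, h1.union h4, Set.union_subset h2 h5, ?_⟩
    rintro y (hy | hy)
    · exact (h3 y hy).trans_le (measure_mono (Set.preimage_mono Set.subset_union_left))
    · exact (h6 y hy).trans_le (measure_mono (Set.preimage_mono Set.subset_union_right))
  · intro x hx
    obtain ⟨W, hW, D, h1, h2, h3⟩ := exists_nhds_compact n hU (h x hx)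
    exact ⟨W, mem_nhdsWithin_of_mem_nhds hW, D, h1, h2, h3⟩

theorem measurable_translate (n : Measure G) [IsFiniteMeasure n] [n.Regular] {s : Set G}
    (hs : MeasurableSet s) : Measurable fun x : G => n ((x * ·) ⁻¹' s) := by
  have hm : ∀ x : G, Measurable (x * · : G → G) := fun x => (continuous_const_mul x).measurable
  induction s, hs using MeasurableSpace.induction_on_inter
    (BorelSpace.measurable_eq (α := G)) isPiSystem_isOpen with
  | empty => simp
  | basic U hU =>
    exact measurable_of_Ioi fun t => (isOpen_lt_translate n hU t).measurableSet
  | compl s hs ih =>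
    have : (fun x : G => n ((x * ·) ⁻¹' sᶜ)) =
        fun x : G => n Set.univ - n ((x * ·) ⁻¹' s) := by
      funext x
      rw [Set.preimage_compl, measure_compl (hm x hs) (measure_ne_top n _)]
    rw [this]
    exact ih.const_sub _
  | iUnion f hfd hfm ih =>
    have : (fun x : G => n ((x * ·) ⁻¹' ⋃ i, f i)) =
        fun x : G => ∑' i, n ((x * ·) ⁻¹' f i) := by
      funext x
      rw [Set.preimage_iUnion, measure_iUnion (fun i j hij => (hfd hij).preimage _)
        (fun i => hm x (hfm i))]
    rw [this]
    exact Measurable.tsum ih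

theorem measurable_map_translate (n : Measure G) [IsFiniteMeasure n] [n.Regular] :
    Measurable fun x : G => n.map (x * ·) := by
  refine Measure.measurable_of_measurable_coe _ fun s hs => ?_
  have : (fun x : G => n.map (x * ·) s) = fun x : G => n ((x * ·) ⁻¹' s) := by
    funext x
    exact Measure.map_apply (continuous_const_mul x).measurable hs
  rw [this]
  exact measurable_translate n hs

theorem bind_translate_apply (m n : Measure G) [IsFiniteMeasure n] [n.Regular] {s : Set G}
    (hs : MeasurableSet s) :
    m.bind (fun x : G => n.map (x * ·)) s = ∫⁻ x, n ((x * ·) ⁻¹' s) ∂m := by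
  rw [Measure.bind_apply hs (measurable_map_translate n).aemeasurable]
  exact lintegral_congr fun x => Measure.map_apply (continuous_const_mul x).measurable hs

instance isFiniteMeasure_bind (m n : Measure G) [IsFiniteMeasure m] [IsFiniteMeasure n]
    [n.Regular] : IsFiniteMeasure (m.bind (fun x : G => n.map (x * ·))) := by
  refine ⟨?_⟩
  rw [bind_translate_apply m n MeasurableSet.univ]
  simp only [Set.preimage_univ, lintegral_const]
  exact ENNReal.mul_lt_top (measure_lt_top n _) (measure_lt_top m _)

/-- The convolution of two finite regular Borel measures is regular. -/
theorem regular_bind (m n : Measure G) [IsFiniteMeasure m] [m.Regular] [IsFiniteMeasure n]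
    [n.Regular] : (m.bind (fun x : G => n.map (x * ·))).Regular := by
  set ρ := m.bind (fun x : G => n.map (x * ·)) with hρ
  have key : ρ.InnerRegularWRT IsCompact IsOpen := by
    intro U hU r hr
    have hV : ∀ t : ℚ, IsOpen {x : G | (Real.toNNReal t : ENNReal) < n ((x * ·) ⁻¹' U)} :=
      fun t => isOpen_lt_translate n hU _
    have hK : ∀ (t : ℚ) (k : ℕ), ∃ K ⊆ {x : G | (Real.toNNReal t : ENNReal) < n ((x * ·) ⁻¹' U)},
        IsCompact K ∧ m ({x : G | (Real.toNNReal t : ENNReal) < n ((x * ·) ⁻¹' U)} \ K) <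
          ((k : ENNReal) + 1)⁻¹ := fun t k =>
      (hV t).measurableSet.exists_isCompact_sdiff_lt (measure_ne_top m _) (by simp)
    choose K hKV hKc hKm using hK
    have hD := fun (t : ℚ) (k : ℕ) =>
      exists_compact_of_compact n hU (hKc t k) (fun x hx => hKV t k hx)
    choose D hDc hDU hDn using hD
    have hae : ∀ᵐ x ∂m, n ((x * ·) ⁻¹' U) ≤ n ((x * ·) ⁻¹' ⋃ p : ℚ × ℕ, D p.1 p.2) := by
      have h1 : ∀ᵐ x ∂m, ∀ t : ℚ,
          (Real.toNNReal t : ENNReal) < n ((x * ·) ⁻¹' U) → ∃ k, x ∈ K t k := by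
        rw [ae_all_iff]
        intro t
        rw [ae_iff]
        refine le_antisymm (ENNReal.le_of_forall_pos_le_add fun ε hε _ => ?_) (zero_le)
        obtain ⟨k, hk⟩ := ENNReal.exists_inv_nat_lt (ENNReal.coe_pos.2 hε).ne'
        rw [zero_add]
        refine le_trans (measure_mono (t := {x : G | (Real.toNNReal t : ENNReal) <
          n ((x * ·) ⁻¹' U)} \ K t k) ?_) ((hKm t k).le.trans ?_)
        · intro x hx
          simp only [Set.mem_ofPred_eq, Classical.not_imp, not_exists] at hx
          exact ⟨hx.1, hx.2 k⟩
        · refine le_trans ?_ hk.le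
          exact ENNReal.inv_le_inv.2 le_self_add
      filter_upwards [h1] with x hx
      refine le_of_forall_lt fun c hc => ?_
      obtain ⟨q, hcq, hq⟩ := ENNReal.lt_iff_exists_nnreal_btwn.1 hc
      obtain ⟨t, ht1, ht2⟩ := ENNReal.lt_iff_exists_rat_btwn.1 hq
      obtain ⟨k, hk⟩ := hx t ht2.2
      refine hcq.trans (ht2.1.trans ((hDn _ k x hk).trans_le (measure_mono ?_)))
      exact Set.preimage_mono (Set.subset_iUnion (fun p : ℚ × ℕ => D p.1 p.2) (t, k))
    have hDm : MeasurableSet (⋃ p : ℚ × ℕ, D p.1 p.2) :=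
      MeasurableSet.iUnion fun p => (hDc p.1 p.2).measurableSet
    have hle : ρ U ≤ ρ (⋃ p : ℚ × ℕ, D p.1 p.2) := by
      rw [hρ, bind_translate_apply m n hU.measurableSet, bind_translate_apply m n hDm]
      exact lintegral_mono_ae hae
    have hr' := hr.trans_le hle
    rw [Set.iUnion_eq_iUnion_finset, Directed.measure_iUnion, lt_iSup_iff] at hr'
    · obtain ⟨F, hF⟩ := hr'
      exact ⟨⋃ p ∈ F, D p.1 p.2, Set.iUnion₂_subset fun p _ => hDU p.1 p.2,
        F.isCompact_biUnion fun p _ => hDc p.1 p.2, hF⟩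
    · exact Monotone.directed_le fun F F' hFF' => Set.biUnion_subset_biUnion_left hFF'
  have hw : ρ.WeaklyRegular := by
    refine Measure.InnerRegularWRT.weaklyRegular_of_finite ρ ?_
    intro U hU r hr
    obtain ⟨K, h1, h2, h3⟩ := key hU r hr
    exact ⟨K, h1, h2.isClosed, h3⟩
  exact { innerRegular := key }

end Translation

section Algebra

set_option linter.unusedSectionVars false

variable (G : Type*) [Group G] [TopologicalSpace G] [IsTopologicalGroup G]
  [LocallyCompactSpace G] [T2Space G] [MeasurableSpace G] [BorelSpace G]

/-- The measure algebra `M(G)`: the complex vector space of all regular complex Borel measures on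
`G`, that is, those complex measures whose total variation is a regular Borel measure. Its product
is the convolution, defined below. -/
def MeasureAlgebra : Submodule ℂ (ComplexMeasure G) where
  carrier := {μ | μ.variation.Regular}
  zero_mem' := by
    change (0 : ComplexMeasure G).variation.Regular
    rw [VectorMeasure.variation_zero]
    infer_instance
  add_mem' := by
    intro μ ν (hμ : μ.variation.Regular) (hν : ν.variation.Regular)
    exact regular_of_le VectorMeasure.variation_add_le
  smul_mem' := by
    intro c μ (hμ : μ.variation.Regular)
    change (c • μ).variation.Regular
    rw [VectorMeasure.variation_smul]
    infer_instance

variable {G}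

instance regular_variation (μ : MeasureAlgebra G) : (μ : ComplexMeasure G).variation.Regular :=
  μ.2

theorem measurable_apply_translate (ν : MeasureAlgebra G) {s : Set G} (hs : MeasurableSet s) :
    Measurable fun x : G => (ν : ComplexMeasure G) ((x * ·) ⁻¹' s) := by
  have key : ∀ σ : SignedMeasure G, σ.totalVariation ≤ (ν : ComplexMeasure G).variation →
      Measurable fun x : G => σ ((x * ·) ⁻¹' s) := by
    intro σ hσ
    have h1 : σ.toJordanDecomposition.posPart.Regular :=
      regular_of_le ((Measure.le_add_right le_rfl).trans hσ)
    have h2 : σ.toJordanDecomposition.negPart.Regular :=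
      regular_of_le ((Measure.le_add_left le_rfl).trans hσ)
    have : (fun x : G => σ ((x * ·) ⁻¹' s)) = fun x : G =>
        (σ.toJordanDecomposition.posPart ((x * ·) ⁻¹' s)).toReal -
          (σ.toJordanDecomposition.negPart ((x * ·) ⁻¹' s)).toReal := by
      funext x
      exact σ.apply_eq_posPart_real_sub_negPart_real ((continuous_const_mul x).measurable hs)
    rw [this]
    exact (measurable_translate _ hs).ennreal_toReal.sub (measurable_translate _ hs).ennreal_toReal
  have h : (fun x : G => (ν : ComplexMeasure G) ((x * ·) ⁻¹' s)) = fun x : G =>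
      ((ComplexMeasure.re (ν : ComplexMeasure G) ((x * ·) ⁻¹' s) : ℝ) : ℂ) +
        ((ComplexMeasure.im (ν : ComplexMeasure G) ((x * ·) ⁻¹' s) : ℝ) : ℂ) * Complex.I := by
    funext x
    exact (Complex.re_add_im _).symm
  rw [h]
  exact (Complex.measurable_ofReal.comp (key _ (re_totalVariation_le _))).add
    ((Complex.measurable_ofReal.comp (key _ (im_totalVariation_le _))).mul_const _)

open scoped Classical in
/-- The convolution of regular complex Borel measures as a complex measure:
`(μ * ν)(E) = ∫ ν(x⁻¹E) dμ(x)` for Borel sets `E`. -/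
noncomputable def convMeasure (μ ν : MeasureAlgebra G) : ComplexMeasure G where
  measureOf' E := if MeasurableSet E then
    cintegral (μ : ComplexMeasure G) fun x => (ν : ComplexMeasure G) ((x * ·) ⁻¹' E) else 0
  empty' := by simp [cintegral]
  not_measurable' := by simp +contextual
  m_iUnion' f f_meas f_disj := by
    have hm : ∀ x : G, Measurable (x * · : G → G) := fun x => (continuous_const_mul x).measurable
    simp only [f_meas, ↓reduceIte, implies_true, MeasurableSet.iUnion, Set.preimage_iUnion,
      HasSum, SummationFilter.unconditional_filter, cintegral]
    have A (a : Finset ℕ) : ∑ i ∈ a, ∫ᵛ x, (ν : ComplexMeasure G) ((x * ·) ⁻¹' f i)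
          ∂[ContinuousLinearMap.mul ℝ ℂ; (μ : ComplexMeasure G)]
        = ∫ᵛ x, ∑ i ∈ a, (ν : ComplexMeasure G) ((x * ·) ⁻¹' f i)
          ∂[ContinuousLinearMap.mul ℝ ℂ; (μ : ComplexMeasure G)] := by
      rw [VectorMeasure.integral_finsetSum _ fun i _ => integrable_of_bounded _
        (measurable_apply_translate ν (f_meas i)) fun x => VectorMeasure.norm_apply_le_bound]
    simp_rw [A]
    refine VectorMeasure.tendsto_integral_filter_of_norm_le_const
      (Filter.Eventually.of_forall fun a => ?_)
      ⟨(ν : ComplexMeasure G).bound, Filter.Eventually.of_forall fun a =>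
        Filter.Eventually.of_forall fun x => ?_⟩ (Filter.Eventually.of_forall fun x => ?_)
    · exact (Finset.measurable_fun_sum a fun i _ =>
        measurable_apply_translate ν (f_meas i)).aestronglyMeasurable
    · rw [← VectorMeasure.of_biUnion_finset]
      · exact VectorMeasure.norm_apply_le_bound
      · exact fun i _ j _ hij => (f_disj hij).preimage _
      · exact fun i _ => hm x (f_meas i)
    · exact VectorMeasure.hasSum_of_disjoint_iUnion (fun i => hm x (f_meas i))
        fun i j hij => (f_disj hij).preimage _

theorem convMeasure_apply (μ ν : MeasureAlgebra G) {E : Set G} (hE : MeasurableSet E) :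
    convMeasure μ ν E =
      cintegral (μ : ComplexMeasure G) fun x => (ν : ComplexMeasure G) ((x * ·) ⁻¹' E) :=
  if_pos hE

theorem convMeasure_mem (μ ν : MeasureAlgebra G) : convMeasure μ ν ∈ MeasureAlgebra G := by
  have hr := regular_bind (μ : ComplexMeasure G).variation (ν : ComplexMeasure G).variation
  refine regular_of_le (m := (μ : ComplexMeasure G).variation.bind
    fun x : G => (ν : ComplexMeasure G).variation.map (x * ·)) ?_
  refine VectorMeasure.variation_le_of_forall_enorm_le fun E hE => ?_
  rw [bind_translate_apply _ _ hE, convMeasure_apply μ ν hE]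
  refine VectorMeasure.enorm_integral_le_lintegral_enorm.trans ?_
  have h1 : ‖ContinuousLinearMap.mul ℝ ℂ‖ₑ = 1 := by
    rw [← ofReal_norm, ContinuousLinearMap.opNorm_mul, ENNReal.ofReal_one]
  rw [h1, one_mul]
  exact lintegral_mono fun x => VectorMeasure.enorm_measure_le_variation _ _

noncomputable instance : Mul (MeasureAlgebra G) := ⟨fun μ ν => ⟨convMeasure μ ν, convMeasure_mem μ ν⟩⟩

theorem mul_apply (μ ν : MeasureAlgebra G) {E : Set G} (hE : MeasurableSet E) :
    (μ * ν : MeasureAlgebra G).1 E =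
      cintegral (μ : ComplexMeasure G) fun x => (ν : ComplexMeasure G) ((x * ·) ⁻¹' E) :=
  convMeasure_apply μ ν hE

/-- The unit of the measure algebra is the point mass `δ_e` at the identity of `G`. -/
noncomputable instance : One (MeasureAlgebra G) := ⟨⟨VectorMeasure.dirac 1 1, by
  change (VectorMeasure.dirac (1 : G) (1 : ℂ)).variation.Regular
  have : (Measure.dirac (1 : G)).InnerRegularCompactLTTop := by
    refine ⟨fun A hA r hr => ?_⟩
    by_cases h : (1 : G) ∈ A
    · exact ⟨{1}, Set.singleton_subset_iff.2 h, isCompact_singleton, by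
        simpa [Measure.dirac_apply' _ hA.1, h] using hr⟩
    · simp [Measure.dirac_apply' _ hA.1, h] at hr
  simpa using (inferInstance : (Measure.dirac (1 : G)).Regular)⟩⟩

theorem one_val : ((1 : MeasureAlgebra G) : ComplexMeasure G) = VectorMeasure.dirac 1 1 := rfl

/-- Integration against a convolution: `∫ f d(μ * ν) = ∫∫ f(xy) dν(y) dμ(x)`. -/
theorem cintegral_mul (μ ν : MeasureAlgebra G) {f : G → ℂ} (hf : Measurable f) {C : ℝ}
    (hC : ∀ x, ‖f x‖ ≤ C) :
    (Measurable fun x => cintegral (ν : ComplexMeasure G) fun y => f (x * y)) ∧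
    cintegral (μ * ν : MeasureAlgebra G).1 f =
      cintegral (μ : ComplexMeasure G) fun x => cintegral (ν : ComplexMeasure G) fun y =>
        f (x * y) := by
  have hm : ∀ x : G, Measurable (x * · : G → G) := fun x => (continuous_const_mul x).measurable
  have hs : ∀ g : SimpleFunc G ℂ,
      (Measurable fun x => cintegral (ν : ComplexMeasure G) fun y => g (x * y)) ∧
      cintegral (μ * ν : MeasureAlgebra G).1 g =
        cintegral (μ : ComplexMeasure G) fun x => cintegral (ν : ComplexMeasure G) fun y =>
          g (x * y) := by
    have hb : ∀ g : SimpleFunc G ℂ, ∃ D, ∀ x, ‖g x‖ ≤ D := fun g => by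
      obtain ⟨D, hD⟩ := g.exists_forall_norm_le
      exact ⟨D, hD⟩
    intro g
    classical
    induction g using SimpleFunc.induction with
    | @const c s hs =>
      have h1 : ∀ x, (cintegral (ν : ComplexMeasure G) fun y =>
          (s.indicator (fun _ => c) (x * y) : ℂ)) =
            c * (ν : ComplexMeasure G) ((x * ·) ⁻¹' s) := fun x =>
        cintegral_indicator (ν : ComplexMeasure G) c (hm x hs)
      have h2 : ∀ z, (SimpleFunc.piecewise s hs (SimpleFunc.const G c) (SimpleFunc.const G 0)) z =
          s.indicator (fun _ => c) z := fun z => by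
        rw [SimpleFunc.coe_piecewise, SimpleFunc.coe_const, SimpleFunc.coe_const]
        exact congrFun (Set.piecewise_eq_indicator (f := fun _ => c)) z
      have h3 : ⇑(SimpleFunc.piecewise s hs (SimpleFunc.const G c) (SimpleFunc.const G 0)) =
          s.indicator (fun _ => c) := funext h2
      simp only [h3, h1]
      refine ⟨(measurable_apply_translate ν hs).const_mul c, ?_⟩
      rw [cintegral_indicator _ c hs, mul_apply μ ν hs, cintegral_const_mul]
      exact integrable_of_bounded _ (measurable_apply_translate ν hs)
        fun x => VectorMeasure.norm_apply_le_bound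
    | @add g h hgh ihg ihh =>
      obtain ⟨D, hD⟩ := hb g
      obtain ⟨E, hE⟩ := hb h
      have h1 : ∀ x, (cintegral (ν : ComplexMeasure G) fun y => (g + h) (x * y)) =
          (cintegral (ν : ComplexMeasure G) fun y => g (x * y)) +
            cintegral (ν : ComplexMeasure G) fun y => h (x * y) := fun x =>
        cintegral_add (ν : ComplexMeasure G)
          (integrable_of_bounded _ (g.measurable.comp (hm x)) fun y => hD (x * y))
          (integrable_of_bounded _ (h.measurable.comp (hm x)) fun y => hE (x * y))
      simp only [h1]
      refine ⟨ihg.1.add ihh.1, ?_⟩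
      rw [cintegral_add _ (integrable_of_bounded _ ihg.1 fun x =>
          norm_cintegral_le _ fun y => hD (x * y))
        (integrable_of_bounded _ ihh.1 fun x => norm_cintegral_le _ fun y => hE (x * y)),
        ← ihg.2, ← ihh.2]
      exact cintegral_add _ (integrable_of_bounded _ g.measurable hD)
        (integrable_of_bounded _ h.measurable hE)
  have hC0 : 0 ≤ C := (norm_nonneg _).trans (hC 1)
  have hsm := hf.stronglyMeasurable
  set F := hsm.approxBounded C with hF
  have hFC : ∀ n x, ‖F n x‖ ≤ C := fun n x => hsm.norm_approxBounded_le hC0 n x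
  have hlim : ∀ x, Filter.Tendsto (fun n => F n x) Filter.atTop (nhds (f x)) := fun x =>
    hsm.tendsto_approxBounded_of_norm_le (hC x)
  have hinner : ∀ x, Filter.Tendsto
      (fun n => cintegral (ν : ComplexMeasure G) fun y => F n (x * y)) Filter.atTop
      (nhds (cintegral (ν : ComplexMeasure G) fun y => f (x * y))) := fun x =>
    tendsto_cintegral _ (fun n => (F n).measurable.comp (hm x)) (fun n y => hFC n (x * y))
      fun y => hlim (x * y)
  refine ⟨measurable_of_tendsto_metrizable (fun n => (hs (F n)).1) (tendsto_pi_nhds.2 hinner), ?_⟩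
  refine tendsto_nhds_unique
    (tendsto_cintegral _ (fun n => (F n).measurable) hFC hlim) ?_
  simp only [(hs _).2]
  exact tendsto_cintegral _ (fun n => (hs (F n)).1)
    (fun n x => norm_cintegral_le _ fun y => hFC n (x * y)) hinner

theorem ext_measure {μ ν : MeasureAlgebra G}
    (h : ∀ E, MeasurableSet E → (μ : ComplexMeasure G) E = (ν : ComplexMeasure G) E) : μ = ν :=
  Subtype.ext (VectorMeasure.ext h)

/-- The measure algebra is a ring under addition of measures and convolution. -/
noncomputable instance : Ring (MeasureAlgebra G) where
  toAddCommGroup := inferInstance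
  mul_assoc a b c := ext_measure fun E hE => by
    have hm : ∀ x : G, Measurable (x * · : G → G) := fun x => (continuous_const_mul x).measurable
    rw [mul_apply _ _ hE, mul_apply _ _ hE, (cintegral_mul a b (measurable_apply_translate c hE)
      fun x => VectorMeasure.norm_apply_le_bound).2]
    congr 1
    funext x
    rw [mul_apply _ _ (hm x hE)]
    congr 1
    funext y
    congr 1
    ext z
    simp [mul_assoc]
  one_mul a := ext_measure fun E hE => by
    rw [mul_apply _ _ hE, one_val, cintegral, VectorMeasure.integral_dirac'
      (measurable_apply_translate a hE).stronglyMeasurable]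
    simp
  mul_one a := ext_measure fun E hE => by
    have h : (fun x : G => ((1 : MeasureAlgebra G) : ComplexMeasure G) ((x * ·) ⁻¹' E)) =
        E.indicator fun _ => 1 := by
      funext x
      have hx : MeasurableSet ((x * ·) ⁻¹' E) := (continuous_const_mul x).measurable hE
      by_cases hxE : x ∈ E <;> simp [one_val, hx, hxE]
    rw [mul_apply _ _ hE, h, cintegral_indicator _ _ hE, one_mul]
  left_distrib a b c := ext_measure fun E hE => by
    rw [mul_apply _ _ hE]
    change _ = (a * b : MeasureAlgebra G).1 E + (a * c : MeasureAlgebra G).1 E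
    rw [mul_apply _ _ hE, mul_apply _ _ hE]
    exact cintegral_add _ (integrable_of_bounded _ (measurable_apply_translate b hE)
      fun x => VectorMeasure.norm_apply_le_bound)
      (integrable_of_bounded _ (measurable_apply_translate c hE)
      fun x => VectorMeasure.norm_apply_le_bound)
  right_distrib a b c := ext_measure fun E hE => by
    rw [mul_apply _ _ hE]
    change _ = (a * c : MeasureAlgebra G).1 E + (b * c : MeasureAlgebra G).1 E
    rw [mul_apply _ _ hE, mul_apply _ _ hE]
    exact cintegral_add_measure _ _ (measurable_apply_translate c hE)
      fun x => VectorMeasure.norm_apply_le_bound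
  zero_mul a := ext_measure fun E hE => by
    rw [mul_apply _ _ hE]
    simp [cintegral]
  mul_zero a := ext_measure fun E hE => by
    rw [mul_apply _ _ hE]
    simp [cintegral]

theorem mul_univ (μ ν : MeasureAlgebra G) : (μ * ν : MeasureAlgebra G).1 Set.univ =
    (ν : ComplexMeasure G) Set.univ * (μ : ComplexMeasure G) Set.univ := by
  rw [mul_apply _ _ MeasurableSet.univ]
  simp [cintegral_const]

/-- The complex scalars make the measure algebra an algebra over `ℂ`. -/
noncomputable instance : Algebra ℂ (MeasureAlgebra G) :=
  Algebra.ofModule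
    (fun c a b => ext_measure fun E hE => by
      rw [mul_apply _ _ hE]
      change _ = c * (a * b : MeasureAlgebra G).1 E
      rw [mul_apply _ _ hE]
      exact cintegral_smul_measure _ _ (measurable_apply_translate b hE)
        fun x => VectorMeasure.norm_apply_le_bound)
    (fun c a b => ext_measure fun E hE => by
      rw [mul_apply _ _ hE]
      change _ = c * (a * b : MeasureAlgebra G).1 E
      rw [mul_apply _ _ hE]
      exact cintegral_const_mul _ _ (integrable_of_bounded _ (measurable_apply_translate b hE)
        fun x => VectorMeasure.norm_apply_le_bound))

variable (G) in
/-- The augmentation ideal `M₀(G) = {μ ∈ M(G) : μ(G) = 0}`, as a left ideal of `M(G)`. -/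
noncomputable def augmentationIdeal : Ideal (MeasureAlgebra G) where
  carrier := {μ | (μ : ComplexMeasure G) Set.univ = 0}
  zero_mem' := rfl
  add_mem' := by
    intro μ ν (hμ : (μ : ComplexMeasure G) Set.univ = 0) (hν : (ν : ComplexMeasure G) Set.univ = 0)
    change (μ : ComplexMeasure G) Set.univ + (ν : ComplexMeasure G) Set.univ = 0
    rw [hμ, hν, add_zero]
  smul_mem' := by
    intro μ ν (hν : (ν : ComplexMeasure G) Set.univ = 0)
    change (μ * ν : MeasureAlgebra G).1 Set.univ = 0
    rw [mul_univ, hν, zero_mul]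

end Algebra

end MeasureAlg

namespace MeasureAlg

set_option linter.unusedSectionVars false

/-! ### Positive measures inside `M(G)`, and the compact case. -/

section OfMeasure

variable {G : Type*} [Group G] [TopologicalSpace G] [IsTopologicalGroup G]
  [LocallyCompactSpace G] [T2Space G] [MeasurableSpace G] [BorelSpace G]

/-! If `G` is compact with normalized Haar measure `λ`, invariance gives `μ * λ = μ(G) λ`. This
vanishes on the augmentation ideal, so `μ = μ * (δ_e - λ)` there and one generator suffices.

If `G` is not compact, finite generation is refuted by a rate of decay. A generator `s` has total
mass zero and is nearly concentrated on a compact set `K`. In `(a * s)(B)`, a point `x` with `xK ⊆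
B`, or with `xK` disjoint from `B`, contributes almost nothing, so only the mass of `a` near the
boundary of `B` matters (`enorm_mul_apply_le`). With compact sets `B k` growing fast enough for the
finitely many generators, the errors are geometric and the boundary layers overlap boundedly. Hence
`∑ |ν(B k)|` is finite for every `ν` in the left ideal, whatever the coefficients
(`exists_compact_seq`).

Yet no single sequence of compact sets can serve the whole augmentation ideal. Moving mass from `e`
to points that leave the `B k` slowly in terms of mass but late in `k` yields a `ν` of total mass
zero with `∑ |ν(B k)| = ∞` (`exists_augmentation_tsum_eq_top`). -/

variable (G) in
theorem mem_augmentationIdeal {μ : MeasureAlgebra G} :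
    μ ∈ augmentationIdeal G ↔ (μ : ComplexMeasure G) Set.univ = 0 := Iff.rfl

/-- A finite positive measure, seen as a complex measure. -/
noncomputable def complexOfMeasure {X : Type*} [MeasurableSpace X] (m : Measure X)
    [IsFiniteMeasure m] : ComplexMeasure X :=
  m.toSignedMeasure.mapRange Complex.ofRealHom.toAddMonoidHom Complex.continuous_ofReal

theorem complexOfMeasure_apply {X : Type*} [MeasurableSpace X] (m : Measure X)
    [IsFiniteMeasure m] {E : Set X} (hE : MeasurableSet E) :
    complexOfMeasure m E = (m.real E : ℂ) := by
  simp [complexOfMeasure, VectorMeasure.mapRange_apply,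
    Measure.toSignedMeasure_apply_measurable hE]

/-- Domination by `m` is all that is needed to pass regularity from `m` to the variation, through
`regular_of_le`. -/
theorem variation_complexOfMeasure_le {X : Type*} [MeasurableSpace X] (m : Measure X)
    [IsFiniteMeasure m] : (complexOfMeasure m).variation ≤ m := by
  refine VectorMeasure.variation_le_of_forall_enorm_le fun E hE => ?_
  rw [complexOfMeasure_apply m hE, ← ofReal_norm]
  simp [Measure.real, abs_of_nonneg]

/-- A finite regular positive measure, seen as an element of the measure algebra. -/
noncomputable def ofMeasure (m : Measure G) [IsFiniteMeasure m] [m.Regular] : MeasureAlgebra G :=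
  ⟨complexOfMeasure m, regular_of_le (variation_complexOfMeasure_le m)⟩

theorem ofMeasure_apply (m : Measure G) [IsFiniteMeasure m] [m.Regular] {E : Set G}
    (hE : MeasurableSet E) : (ofMeasure m : ComplexMeasure G) E = (m.real E : ℂ) :=
  complexOfMeasure_apply m hE

/-- On a compact group the augmentation ideal is generated by `δ_e - λ`, with `λ` the normalized
Haar measure. -/
theorem augmentationIdeal_fg_of_compact [CompactSpace G] : (augmentationIdeal G).FG := by
  have hh : IsProbabilityMeasure (Measure.haarMeasure (⊤ : TopologicalSpace.PositiveCompacts G)) :=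
    ⟨Measure.haarMeasure_self⟩
  set h := Measure.haarMeasure (⊤ : TopologicalSpace.PositiveCompacts G)
  have hu : (ofMeasure h : ComplexMeasure G) Set.univ = 1 := by
    simp [ofMeasure_apply h MeasurableSet.univ]
  have hm : ∀ μ ∈ augmentationIdeal G, μ * ofMeasure h = 0 := by
    intro μ hμ
    refine ext_measure fun E hE => ?_
    -- Left invariance makes the integrand of the convolution constant, so the integral is a
    -- multiple of `μ(G) = 0`.
    have hc : ∀ x : G, (ofMeasure h : ComplexMeasure G) ((x * ·) ⁻¹' E) =
        (ofMeasure h : ComplexMeasure G) E := fun x => by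
      rw [ofMeasure_apply h hE, ofMeasure_apply h ((continuous_const_mul x).measurable hE),
        Measure.real, Measure.real, measure_preimage_mul]
    rw [mul_apply _ _ hE]
    simp only [hc, cintegral_const]
    rw [(mem_augmentationIdeal G).1 hμ, mul_zero]
    rfl
  refine ⟨{1 - ofMeasure h}, le_antisymm ?_ fun μ hμ => ?_⟩
  · rw [Finset.coe_singleton, Ideal.span_le, Set.singleton_subset_iff]
    change ((1 : MeasureAlgebra G) : ComplexMeasure G) Set.univ -
      (ofMeasure h : ComplexMeasure G) Set.univ = 0
    rw [hu, one_val, VectorMeasure.dirac_apply_of_mem MeasurableSet.univ (Set.mem_univ _), sub_self]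
  · rw [Finset.coe_singleton]
    refine Ideal.mem_span_singleton'.2 ⟨μ, ?_⟩
    rw [mul_sub, mul_one, hm μ hμ, sub_zero]

end OfMeasure

/-! ### The non-compact case: summability along compact exhaustions. -/

section NonCompact

open scoped Pointwise

variable {G : Type*} [Group G] [TopologicalSpace G] [IsTopologicalGroup G]
  [LocallyCompactSpace G] [T2Space G] [MeasurableSpace G] [BorelSpace G]

theorem enorm_cintegral_le {X : Type*} [MeasurableSpace X] (μ : ComplexMeasure X) (f : X → ℂ) :
    ‖cintegral μ f‖ₑ ≤ ∫⁻ x, ‖f x‖ₑ ∂μ.variation := by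
  refine VectorMeasure.enorm_integral_le_lintegral_enorm.trans_eq ?_
  rw [← ofReal_norm, ContinuousLinearMap.opNorm_mul, ENNReal.ofReal_one, one_mul]

/-- If `μ` has total mass zero and is concentrated on `K` up to `ε`, then `(a * μ)(B)` is controlled
by the mass of `a` near the boundary of `B`. -/
theorem enorm_mul_apply_le (a : MeasureAlgebra G) {μ : MeasureAlgebra G}
    (hμ : μ ∈ augmentationIdeal G) {A B C K : Set G} (hA : MeasurableSet A) (hB : MeasurableSet B)
    (hC : MeasurableSet C) {ε : ENNReal} (hε : (μ : ComplexMeasure G).variation Kᶜ ≤ ε)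
    (hAB : ∀ x ∈ A, ∀ k ∈ K, x * k ∈ B) (hBC : ∀ x, ∀ k ∈ K, x * k ∈ B → x ∈ C) :
    ‖(a * μ : MeasureAlgebra G).1 B‖ₑ ≤ ε * (a : ComplexMeasure G).variation Set.univ +
      (μ : ComplexMeasure G).variation Set.univ * (a : ComplexMeasure G).variation (C \ A) := by
  rw [mul_apply _ _ hB]
  refine (enorm_cintegral_le _ _).trans ?_
  -- The integrand is at most `ε` on `A` and off `C`; only on `C \ A` is the trivial bound by the
  -- total variation used.
  have key : ∀ x, ‖(μ : ComplexMeasure G) ((x * ·) ⁻¹' B)‖ₑ ≤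
      ε + (C \ A).indicator (fun _ => (μ : ComplexMeasure G).variation Set.univ) x := by
    intro x
    have hx : MeasurableSet ((x * ·) ⁻¹' B) := (continuous_const_mul x).measurable hB
    by_cases hxA : x ∈ A
    · have h0 : (μ : ComplexMeasure G) ((x * ·) ⁻¹' B) =
          -(μ : ComplexMeasure G) ((x * ·) ⁻¹' B)ᶜ := by
        rw [eq_neg_iff_add_eq_zero, ← VectorMeasure.of_union disjoint_compl_right hx hx.compl,
          Set.union_compl_self]
        exact hμ
      rw [h0, enorm_neg]
      refine (VectorMeasure.enorm_measure_le_variation _ _).trans (le_add_right ?_)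
      refine (measure_mono ?_).trans hε
      exact Set.compl_subset_compl.2 fun k hk => hAB x hxA k hk
    · by_cases hxC : x ∈ C
      · rw [Set.indicator_of_mem (show x ∈ C \ A from ⟨hxC, hxA⟩)]
        exact (VectorMeasure.enorm_measure_le_variation _ _).trans
          (le_add_left (measure_mono (Set.subset_univ _)))
      -- For `x ∉ C` the set `x⁻¹B` itself misses `K`.
      · refine (VectorMeasure.enorm_measure_le_variation _ _).trans (le_add_right ?_)
        exact (measure_mono fun k hk hkK => hxC (hBC x k hkK hk)).trans hε
  refine (lintegral_mono key).trans_eq ?_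
  rw [lintegral_add_left measurable_const, lintegral_const,
    lintegral_indicator_const (hC.diff hA)]

theorem exists_compact_compl_le (m : Measure G) [IsFiniteMeasure m] [m.Regular] {ε : ENNReal}
    (hε : ε ≠ 0) : ∃ K, IsCompact K ∧ m Kᶜ ≤ ε := by
  obtain ⟨K, -, hK, h⟩ := MeasurableSet.univ.exists_isCompact_sdiff_lt (measure_ne_top m _) hε
  exact ⟨K, hK, by rw [Set.compl_eq_univ_sdiff]; exact h.le⟩

/-- The successive shells of an increasing sequence are disjoint, so their masses add up to at most
the total mass. -/
theorem tsum_measure_diff_le {X : Type*} [MeasurableSpace X] (m : Measure X) {B : ℕ → Set X}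
    (hB : ∀ k, MeasurableSet (B k)) (hmono : Monotone B) :
    ∑' k, m (B (k + 1) \ B k) ≤ m Set.univ := by
  refine tsum_meas_le_meas_iUnion_of_disjoint m (fun k => (hB _).diff (hB k)) ?_ |>.trans
    (measure_mono (Set.subset_univ _))
  refine (pairwise_disjoint_on _).2 fun i j hij => Set.disjoint_left.2 fun x hx hx' => ?_
  exact hx'.2 (hmono hij hx.1)

/-- An exhaustion along which all elements of the left ideal generated by finitely many elements of
the augmentation ideal have summable masses. -/
theorem exists_compact_seq (S : Finset (MeasureAlgebra G))
    (hS : (S : Set (MeasureAlgebra G)) ⊆ (augmentationIdeal G : Set (MeasureAlgebra G))) :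
    ∃ B : ℕ → Set G, Monotone B ∧ (∀ k, IsCompact (B k)) ∧ (∀ k, (1 : G) ∈ B k) ∧
      ∀ ν ∈ Ideal.span (S : Set (MeasureAlgebra G)),
        ∑' k, ‖(ν : ComplexMeasure G) (B (k + 1))‖ₑ ≠ ⊤ := by
  -- Finiteness of `S` enters here: one compact set serves all generators at once.
  have hK : ∀ k : ℕ, ∃ K : Set G, IsCompact K ∧
      ∀ s ∈ S, (s : ComplexMeasure G).variation Kᶜ ≤ 2⁻¹ ^ k := by
    intro k
    have h2 : (2⁻¹ : ENNReal) ^ k ≠ 0 := by simp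
    have h : ∀ s : MeasureAlgebra G, ∃ K, IsCompact K ∧
        (s : ComplexMeasure G).variation Kᶜ ≤ 2⁻¹ ^ k := fun s => exists_compact_compl_le _ h2
    choose K hK hKs using h
    refine ⟨⋃ s ∈ S, K s, S.isCompact_biUnion fun s _ => hK s, fun s hs => ?_⟩
    exact (measure_mono (Set.compl_subset_compl.2
      (Set.subset_biUnion_of_mem (u := K) hs))).trans (hKs s)
  choose K hKc hKs using hK
  -- The three pieces give `B k ⊆ B (k + 1)`, `B k * K (k + 1) ⊆ B (k + 1)` and `B (k + 1) * (K (k +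
  -- 1))⁻¹ ⊆ B (k + 2)`. The last two are what the estimate at `B (k + 1)` with the compact set `K
  -- (k + 1)` requires.
  let L : ℕ → Set G := fun k => {1} ∪ K (k + 1) ∪ (K k)⁻¹
  have hLc : ∀ k, IsCompact (L k) := fun k =>
    (isCompact_singleton.union (hKc _)).union (hKc k).inv
  let B : ℕ → Set G := fun k => Nat.rec {1} (fun k T => T * L k) k
  have hBs : ∀ k, B (k + 1) = B k * L k := fun k => rfl
  have hBc : ∀ k, IsCompact (B k) := fun k => by
    induction k with
    | zero => exact isCompact_singleton
    | succ k ih => exact ih.mul (hLc k)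
  have hBmono : Monotone B := monotone_nat_of_le_succ fun k x hx =>
    Set.mem_mul.2 ⟨x, hx, 1, Or.inl (Or.inl rfl), mul_one x⟩
  have hB1 : ∀ k, (1 : G) ∈ B k := fun k => hBmono (Nat.zero_le k) rfl
  have hBm : ∀ k, MeasurableSet (B k) := fun k => (hBc k).measurableSet
  clear_value B
  refine ⟨B, hBmono, hBc, hB1, fun ν hν => ?_⟩
  have hgen : ∀ (a : MeasureAlgebra G), ∀ s ∈ S,
      ∑' k, ‖(a * s : MeasureAlgebra G).1 (B (k + 1))‖ₑ < ⊤ := by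
    intro a s hs
    have hle : ∀ k, ‖(a * s : MeasureAlgebra G).1 (B (k + 1))‖ₑ ≤
        2⁻¹ ^ (k + 1) * (a : ComplexMeasure G).variation Set.univ +
          (s : ComplexMeasure G).variation Set.univ *
            ((a : ComplexMeasure G).variation (B (k + 1 + 1) \ B (k + 1)) +
              (a : ComplexMeasure G).variation (B (k + 1) \ B k)) := by
      intro k
      refine (enorm_mul_apply_le a (hS hs) (hBm k) (hBm (k + 1)) (hBm (k + 1 + 1)) (hKs (k + 1) s hs)
        (fun x hx y hy => ?_) (fun x y hy hxy => ?_)).trans ?_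
      · rw [hBs k]
        exact Set.mul_mem_mul hx (Or.inl (Or.inr hy))
      · rw [hBs (k + 1)]
        exact Set.mem_mul.2 ⟨x * y, hxy, y⁻¹, Or.inr (Set.inv_mem_inv.2 hy), by group⟩
      -- The layer `B (k + 2) \ B k` overlaps the next one, so it is split into two consecutive
      -- shells, each summable over `k` on its own.
      · gcongr
        refine (measure_mono fun x hx => ?_).trans
          (measure_union_le (B (k + 1 + 1) \ B (k + 1)) (B (k + 1) \ B k))
        by_cases hxB : x ∈ B (k + 1)
        · exact Or.inr ⟨hxB, hx.2⟩
        · exact Or.inl ⟨hx.1, hxB⟩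
    refine (ENNReal.tsum_le_tsum hle).trans_lt ?_
    rw [ENNReal.tsum_add, ENNReal.tsum_mul_right, ENNReal.tsum_mul_left, ENNReal.tsum_add]
    refine ENNReal.add_lt_top.2 ⟨ENNReal.mul_lt_top ?_ (measure_lt_top _ _),
      ENNReal.mul_lt_top (measure_lt_top _ _) (ENNReal.add_lt_top.2 ⟨?_, ?_⟩)⟩
    · simp only [pow_succ]
      rw [ENNReal.tsum_mul_right, ENNReal.tsum_geometric]
      simp [ENNReal.mul_lt_top_iff]
    · exact (tsum_measure_diff_le _ (fun k => hBm (k + 1))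
        fun i j hij => hBmono (Nat.succ_le_succ hij)).trans_lt (measure_lt_top _ _)
    · exact (tsum_measure_diff_le _ hBm hBmono).trans_lt (measure_lt_top _ _)
  obtain ⟨f, -, rfl⟩ := Submodule.mem_span_finset.1 hν
  clear hν
  refine ne_of_lt ?_
  have hsum : ∀ T ⊆ S,
      ∑' k, ‖(∑ s ∈ T, f s • s : MeasureAlgebra G).1 (B (k + 1))‖ₑ < ⊤ := by
    classical
    intro T
    induction T using Finset.induction_on with
    | empty => simp
    | insert s T hs ih =>
      intro hT
      rw [Finset.sum_insert hs]
      refine (ENNReal.tsum_le_tsum fun k => enorm_add_le _ _).trans_lt ?_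
      rw [ENNReal.tsum_add]
      exact ENNReal.add_lt_top.2 ⟨hgen (f s) s (hT (Finset.mem_insert_self s T)),
        ih ((Finset.subset_insert s T).trans hT)⟩
  exact hsum S subset_rfl

/-- On a non-compact group, every increasing sequence of compact sets containing `1` admits an
element of the augmentation ideal with non-summable masses along it. -/
theorem exists_augmentation_tsum_eq_top (hG : ¬CompactSpace G) {B : ℕ → Set G} (hmono : Monotone B)
    (hB : ∀ k, IsCompact (B k)) (h1 : ∀ k, (1 : G) ∈ B k) :
    ∃ ν ∈ augmentationIdeal G, ∑' k, ‖(ν : ComplexMeasure G) (B k)‖ₑ = ⊤ := by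
  -- The index `2 ^ k` is matched to the weight `2⁻¹ ^ k`: the point `x k` lies outside at least `2
  -- ^ k` of the sets.
  have hx : ∀ k, ∃ x, x ∉ B (2 ^ k) := fun k => by
    by_contra! h
    exact hG ⟨(Set.eq_univ_of_forall h) ▸ hB _⟩
  choose x hx using hx
  let p : Measure G := Measure.sum fun k : ℕ => (2⁻¹ : ENNReal) ^ k • Measure.dirac (x k)
  have hpapp : ∀ E, MeasurableSet E → p E = ∑' k, 2⁻¹ ^ k * E.indicator 1 (x k) := fun E hE => by
    simp [p, Measure.sum_apply _ hE, Measure.dirac_apply' _ hE]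
  have hpf : IsFiniteMeasure p := ⟨by
    simp [hpapp _ MeasurableSet.univ, ENNReal.tsum_geometric]⟩
  have hpr : p.Regular := by
    -- Inner regularity survives scaling and countable sums, and for the finite measure `p` it
    -- yields regularity.
    have hd : ∀ y : G, (Measure.dirac y).InnerRegular := fun y => by
      refine ⟨fun A hA r hr => ?_⟩
      by_cases h : y ∈ A
      · exact ⟨{y}, Set.singleton_subset_iff.2 h, isCompact_singleton, by
          simpa [Measure.dirac_apply' _ hA, h] using hr⟩
      · simp [Measure.dirac_apply' _ hA, h] at hr
    have : ∀ k : ℕ, ((2⁻¹ : ENNReal) ^ k • Measure.dirac (x k)).InnerRegular := fun k =>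
      inferInstance
    have : p.InnerRegular := inferInstance
    infer_instance
  -- The witness is `p - p(G) δ_e`. On a set containing `e` it sees only the mass of `p` that lies
  -- outside.
  have hval : ∀ E, MeasurableSet E → (1 : G) ∈ E →
      (ofMeasure p - (p.real Set.univ : ℂ) • (1 : MeasureAlgebra G)).1 E =
        -(p.real Eᶜ : ℂ) := by
    intro E hE h1E
    change (ofMeasure p : ComplexMeasure G) E -
      (p.real Set.univ : ℂ) * ((1 : MeasureAlgebra G) : ComplexMeasure G) E = _
    rw [ofMeasure_apply p hE, one_val, VectorMeasure.dirac_apply_of_mem hE h1E,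
      ← measureReal_add_measureReal_compl hE]
    push_cast
    ring
  refine ⟨ofMeasure p - (p.real Set.univ : ℂ) • (1 : MeasureAlgebra G), ?_, ?_⟩
  · rw [mem_augmentationIdeal, hval _ MeasurableSet.univ (Set.mem_univ _)]
    simp
  · have hBm : ∀ k, MeasurableSet (B k) := fun k => (hB k).measurableSet
    have hn : ∀ k, ‖(ofMeasure p - (p.real Set.univ : ℂ) • (1 : MeasureAlgebra G)).1 (B k)‖ₑ =
        ∑' j, 2⁻¹ ^ j * (B k)ᶜ.indicator 1 (x j) := fun k => by
      rw [hval _ (hBm k) (h1 k), enorm_neg, ← hpapp _ (hBm k).compl, ← ofReal_norm]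
      simp [Measure.real, abs_of_nonneg]
    simp only [hn]
    -- After the exchange of sums, the `j`-th term is `2⁻¹ ^ j` times the number of `k` with `x j ∉
    -- B k`, hence at least `1`.
    rw [ENNReal.tsum_comm, eq_top_iff, ← ENNReal.tsum_const_eq_top_of_ne_zero (α := ℕ) one_ne_zero]
    refine ENNReal.tsum_le_tsum fun j => ?_
    rw [ENNReal.tsum_mul_left]
    calc (1 : ENNReal) = 2⁻¹ ^ j * ∑ k ∈ Finset.range (2 ^ j), 1 := by
          simp [← mul_pow, ENNReal.inv_mul_cancel]
      _ ≤ 2⁻¹ ^ j * ∑ k ∈ Finset.range (2 ^ j), (B k)ᶜ.indicator 1 (x j) := by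
          gcongr with k hk
          have hmem : x j ∈ (B k)ᶜ := fun h => hx j (hmono (Finset.mem_range.1 hk).le h)
          rw [Set.indicator_of_mem hmem]
          rfl
      _ ≤ _ := by
          gcongr
          exact ENNReal.sum_le_tsum _

theorem compactSpace_of_augmentationIdeal_fg (h : (augmentationIdeal G).FG) : CompactSpace G := by
  by_contra hG
  obtain ⟨S, hS⟩ := h
  obtain ⟨B, hmono, hBc, hB1, hB⟩ := exists_compact_seq S (hS ▸ Ideal.subset_span)
  -- The shift by one matches the summability statement, which starts at `B 1` because its estimate
  -- needs a set on either side.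
  obtain ⟨ν, hν, htop⟩ := exists_augmentation_tsum_eq_top hG (B := fun k => B (k + 1))
    (fun i j hij => hmono (Nat.succ_le_succ hij)) (fun k => hBc _) fun k => hB1 _
  exact hB ν (hS.symm ▸ hν) htop

end NonCompact

end MeasureAlg

theorem theorem3p5 {G : Type*} [Group G] [TopologicalSpace G] [IsTopologicalGroup G]
    [LocallyCompactSpace G] [T2Space G] [MeasurableSpace G] [BorelSpace G] :
    (MeasureAlg.augmentationIdeal G).FG ↔ CompactSpace G :=
  ⟨MeasureAlg.compactSpace_of_augmentationIdeal_fg,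
    fun _ => MeasureAlg.augmentationIdeal_fg_of_compact⟩
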